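/- For a closed set $S\subset\mathbb{R}$, let $B_S$ denote the Bernstein space of all bounded continuous functions $f:\mathbb{R}\to\mathbb{C}$ (with the sup-norm) that are Fourier transforms of tempered (Schwartz) distributions supported by $S$; here the Fourier transform is normalized by $\hat F(x)=\int_{\mathbb{R}} e^{itx}F(t)\,dt$ and extended to tempered distributions by duality. A set $\Lambda\subset\mathbb{R}$ is called uniformly discrete if there is $\delta>0$ with $|\lambda-\lambda'|\ge\delta$ for all distinct $\lambda,\lambda'\in\Lambda$, and it is called a set of interpolation for $B_S$ if the restriction operator $f\mapsto f|_\Lambda$ maps $B_S$ onto $\ell^\infty(\Lambda)$. Theorem 3. There is a closed unbounded set $S\subset\mathbb{R}$ of Lebesgue measure zero such that every uniformly discrete set $\Lambda\subset\mathbb{R}$ is a set of interpolation for $B_S$. -/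

import Mathlib

open scoped SchwartzMap BoundedContinuousFunction FourierTransform ENNReal

noncomputable section

namespace Bernstein

/-- The dilation `t ↦ (2π)⁻¹ t` of the real line. -/
def dilation : ℝ ≃L[ℝ] ℝ :=
  ContinuousLinearEquiv.unitsEquivAut ℝ
    (Units.mk0 (2 * Real.pi)⁻¹ (inv_ne_zero Real.two_pi_pos.ne'))

/-- The Fourier transform `φ ↦ (t ↦ ∫ e^{itx} φ(x) dx)` on Schwartz functions
(see `schwartzHat_apply`). -/
def schwartzHat : 𝓢(ℝ, ℂ) →L[ℂ] 𝓢(ℝ, ℂ) :=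
  (SchwartzMap.compCLMOfContinuousLinearEquiv ℂ dilation).comp
    (FourierTransform.fourierInvCLM ℂ 𝓢(ℝ, ℂ))

theorem schwartzHat_apply (φ : 𝓢(ℝ, ℂ)) (t : ℝ) :
    schwartzHat φ t = ∫ x : ℝ, Complex.exp (Complex.I * t * x) * φ x := by
  have h : schwartzHat φ t = 𝓕⁻ (φ : ℝ → ℂ) (t * (2 * Real.pi)⁻¹) := by
    rw [← SchwartzMap.fourierInv_coe]
    rfl
  rw [h, Real.fourierInv_eq']
  congr 1
  funext x
  have hpi : (Real.pi : ℂ) ≠ 0 := by exact_mod_cast Real.pi_ne_zero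
  rw [smul_eq_mul]
  congr 2
  simp only [RCLike.inner_apply, conj_trivial]
  push_cast
  field_simp

/-- The bounded continuous function `f` is the Fourier transform of the tempered distribution `F`:
`⟨f, φ⟩ = ⟨F, φ^⟩` for every test function `φ`. -/
def IsFourierTransformOf (f : ℝ →ᵇ ℂ) (F : 𝓢'(ℝ, ℂ)) : Prop :=
  ∀ φ : 𝓢(ℝ, ℂ), ∫ x : ℝ, f x * φ x = F (schwartzHat φ)

theorem integrable_mul_schwartz (f : ℝ →ᵇ ℂ) (φ : 𝓢(ℝ, ℂ)) :
    MeasureTheory.Integrable (fun x : ℝ => f x * φ x) :=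
  (φ.integrable (μ := MeasureTheory.volume)).bdd_mul
    f.continuous.aestronglyMeasurable (Filter.Eventually.of_forall f.norm_coe_le_norm)

theorem dsupport_add_subset {S : Set ℝ} {F G : 𝓢'(ℝ, ℂ)}
    (hF : Distribution.dsupport F ⊆ S) (hG : Distribution.dsupport G ⊆ S) :
    Distribution.dsupport (F + G : 𝓢'(ℝ, ℂ)) ⊆ S := by
  intro x hx
  by_contra hxS
  have h1 := (Distribution.notMem_dsupport_iff x).1 (fun h => hxS (hF h))
  have h2 := (Distribution.notMem_dsupport_iff x).1 (fun h => hxS (hG h))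
  obtain ⟨s, hs, hso, hxs⟩ := h1
  obtain ⟨t, ht, hto, hxt⟩ := h2
  refine (Distribution.notMem_dsupport_iff x).2
    ⟨s ∩ t, fun u hu => ?_, hso.inter hto, hxs, hxt⟩ hx
  have e1 : F u = 0 := hs u (hu.trans Set.inter_subset_left)
  have e2 : G u = 0 := ht u (hu.trans Set.inter_subset_right)
  change F u + G u = 0
  rw [e1, e2, add_zero]

/-- The Bernstein space `B_S`: bounded continuous functions on `ℝ` (with the sup-norm) which are
Fourier transforms of tempered distributions supported by `S`. -/
def bernsteinSpace (S : Set ℝ) : Submodule ℂ (ℝ →ᵇ ℂ) where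
  carrier := {f | ∃ F : 𝓢'(ℝ, ℂ), Distribution.dsupport F ⊆ S ∧ IsFourierTransformOf f F}
  zero_mem' := by
    refine ⟨0, ?_, ?_⟩
    · exact fun x hx => absurd hx ((Distribution.notMem_dsupport_iff x).2
        ⟨Set.univ, fun _ _ => rfl, isOpen_univ, Set.mem_univ x⟩)
    · intro φ
      simp
  add_mem' := by
    rintro f g ⟨F, hF, hf⟩ ⟨G, hG, hg⟩
    refine ⟨F + G, dsupport_add_subset hF hG, fun φ => ?_⟩
    have h := MeasureTheory.integral_add (integrable_mul_schwartz f φ) (integrable_mul_schwartz g φ)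
    simp only [BoundedContinuousFunction.coe_add, Pi.add_apply, add_mul]
    rw [h, hf φ, hg φ]
    rfl
  smul_mem' := by
    rintro c f ⟨F, hF, hf⟩
    refine ⟨c • F, ?_, fun φ => ?_⟩
    · refine (Distribution.dsupport_subset_dsupport fun s _ hs u hu => ?_).trans hF
      change c • F u = 0
      rw [hs u hu, smul_zero]
    · have h := MeasureTheory.integral_const_mul (μ := MeasureTheory.volume) c
        (fun x : ℝ => f x * φ x)
      simp only [BoundedContinuousFunction.coe_smul, smul_eq_mul, mul_assoc]
      rw [h, hf φ]
      rfl

/-- The restriction operator `f ↦ f|_Λ` from `B_S` to `l^∞(Λ)`. -/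
def restriction (S Λ : Set ℝ) : bernsteinSpace S →ₗ[ℂ] lp (fun _ : Λ => ℂ) ∞ where
  toFun f := ⟨fun x => (f : ℝ →ᵇ ℂ) x, memℓp_infty
    ⟨‖(f : ℝ →ᵇ ℂ)‖, by rintro _ ⟨x, rfl⟩; exact (f : ℝ →ᵇ ℂ).norm_coe_le_norm x⟩⟩
  map_add' _ _ := rfl
  map_smul' _ _ := rfl

/-- `Λ` is a set of interpolation for `B_S`: restriction maps `B_S` onto `l^∞(Λ)`. -/
def IsInterpolationSet (S Λ : Set ℝ) : Prop :=
  Function.Surjective (restriction S Λ)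

/-- `Λ` is uniformly discrete: distinct points of `Λ` have distances bounded away from zero. -/
def UniformlyDiscrete (Λ : Set ℝ) : Prop :=
  ∃ δ : ℝ, 0 < δ ∧ ∀ x ∈ Λ, ∀ y ∈ Λ, x ≠ y → δ ≤ |x - y|

end Bernstein

end

open MeasureTheory Complex Filter Topology

namespace Bernstein


/-! By Menshov there is a continuous `G` with `G 0 = 1`, vanishing at infinity, whose spectrum is a
compact null set `K ⊆ [0, 1]`. Modulating and dilating, `x ↦ e^{ij(x-y)} G(N_j(x-y))` has spectrum
in `j + N_j K`, equals 1 at `y` and, for large `N_j`, is as small as desired away from `y`. The set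
`S` is the union over `j` of the null pieces `j + N_j (K ∪ {0})`. Given `Λ`, assign to each point
its own piece: the sum of the peaks weighted by the data interpolates with relative error at most
1/2, and a Neumann series makes it exact (`isInterpolationSet_of_peaks`).

To build `G` (`exists_null_spectrum_tendsto_zero`), a bump is multiplied repeatedly by averages of
`m` weights `Φ(q_i t)`, with `Φ` periodic, of mean one and carried by a set of small density. Each
product shrinks the support. The errors in the Fourier transform are uniformly bounded and, for
sparse `q_i`, essentially disjoint, so their average is `O(1/m)` plus a small term
(`exists_small_support_ft_close`). -/

/-! ### Fourier transforms of integrable functions -/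

/-- The Fourier transform `x ↦ ∫ e^{ixt} h(t) dt` of a function on the real line. -/
noncomputable def ft (h : ℝ → ℂ) (x : ℝ) : ℂ := ∫ t : ℝ, cexp (I * x * t) * h t

theorem norm_cexp_I_mul_mul (x t : ℝ) : ‖cexp (I * x * t)‖ = 1 := by
  have : I * x * t = ((x * t : ℝ) : ℂ) * I := by push_cast; ring
  rw [this, norm_exp_ofReal_mul_I]

theorem integrable_cexp_mul {h : ℝ → ℂ} (hh : Integrable h) (x : ℝ) :
    Integrable (fun t : ℝ => cexp (I * x * t) * h t) :=
  hh.bdd_mul (c := 1) (by fun_prop) (.of_forall fun t => (norm_cexp_I_mul_mul x t).le)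

theorem norm_ft_le (h : ℝ → ℂ) (x : ℝ) : ‖ft h x‖ ≤ ∫ t, ‖h t‖ := by
  refine (norm_integral_le_integral_norm _).trans_eq ?_
  simp [norm_cexp_I_mul_mul]

theorem ft_sub {h g : ℝ → ℂ} (hh : Integrable h) (hg : Integrable g) (x : ℝ) :
    ft (fun t => h t - g t) x = ft h x - ft g x := by
  simp only [ft, mul_sub]
  exact integral_sub (integrable_cexp_mul hh x) (integrable_cexp_mul hg x)

theorem continuous_ft {h : ℝ → ℂ} (hh : Integrable h) : Continuous (ft h) := by
  refine continuous_of_dominated (bound := fun t => ‖h t‖) ?_ ?_ hh.norm ?_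
  · exact fun x => (integrable_cexp_mul hh x).aestronglyMeasurable
  · exact fun x => .of_forall fun t => by simp [norm_cexp_I_mul_mul]
  · exact .of_forall fun t => by fun_prop

theorem tendsto_ft_cocompact (h : ℝ → ℂ) : Tendsto (ft h) (cocompact ℝ) (𝓝 0) := by
  have h1 := Real.tendsto_integral_exp_smul_cocompact h
  have h2 : Tendsto (fun x : ℝ => x * (-(2 * Real.pi)⁻¹)) (cocompact ℝ) (cocompact ℝ) :=
    (Homeomorph.mulRight₀ (-(2 * Real.pi)⁻¹)
      (by simp [Real.pi_ne_zero])).isClosedEmbedding.tendsto_cocompact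
  refine (h1.comp h2).congr fun x => ?_
  simp only [Function.comp_apply, ft]
  congr 1
  funext t
  rw [Circle.smul_def, Real.fourierChar_apply, smul_eq_mul]
  congr 2
  have hpi : (Real.pi : ℂ) ≠ 0 := by exact_mod_cast Real.pi_ne_zero
  push_cast
  field_simp

theorem integral_ft_mul {h g : ℝ → ℂ} (hh : Integrable h) (hg : Integrable g) :
    ∫ x, ft h x * g x = ∫ t, h t * ft g t := by
  have key : Integrable (fun p : ℝ × ℝ => cexp (I * p.1 * p.2) * (g p.1 * h p.2)) :=
    (hg.mul_prod hh).bdd_mul (c := 1) (by fun_prop)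
      (.of_forall fun p => (norm_cexp_I_mul_mul p.1 p.2).le)
  have e1 : ∀ x, ft h x * g x = ∫ t : ℝ, cexp (I * x * t) * (g x * h t) := fun x => by
    rw [ft, ← integral_mul_const]
    congr 1; funext t; ring
  have e2 : ∀ t, h t * ft g t = ∫ x : ℝ, cexp (I * x * t) * (g x * h t) := fun t => by
    rw [ft, ← integral_const_mul]
    congr 1; funext x
    rw [show I * (t : ℂ) * x = I * x * t by ring]; ring
  simp_rw [e1, e2]
  exact integral_integral_swap key

/-! ### Spectra through uniform approximation -/

/-- `f` is a uniform limit of Fourier transforms of integrable functions which vanish on any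
prescribed closed set disjoint from `K`. -/
def ApproxSpectrum (K : Set ℝ) (f : ℝ → ℂ) : Prop :=
  ∀ C : Set ℝ, IsClosed C → Disjoint C K → ∀ ε : ℝ, 0 < ε →
    ∃ h : ℝ → ℂ, Integrable h ∧ (∀ t ∈ C, h t = 0) ∧ ∀ x, ‖f x - ft h x‖ ≤ ε

/-- Moving the transform onto `φ` turns the pairing with `ft h` into `∫ h φ^`, which is zero once
`h` vanishes on the support of `φ^`. -/
theorem ApproxSpectrum.integral_mul_eq_zero {K : Set ℝ} {f : ℝ → ℂ} (hf : ApproxSpectrum K f)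
    (hfc : Continuous f) {φ : 𝓢(ℝ, ℂ)} (hφ : tsupport (schwartzHat φ) ⊆ Kᶜ) :
    ∫ x, f x * φ x = 0 := by
  have hφi : Integrable (φ : ℝ → ℂ) := φ.integrable
  have key : ∀ ε : ℝ, 0 < ε → ‖∫ x, f x * φ x‖ ≤ ε * ∫ x, ‖φ x‖ := by
    intro ε hε
    obtain ⟨h, hh, hC, hfh⟩ :=
      hf _ (isClosed_tsupport _) (Set.disjoint_left.2 fun t ht => hφ ht) ε hε
    have h0 : ∫ x, ft h x * φ x = 0 := by
      rw [integral_ft_mul hh hφi]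
      refine integral_eq_zero_of_ae (.of_forall fun t => ?_)
      have e : ft φ t = schwartzHat φ t := (schwartzHat_apply φ t).symm
      by_cases ht : t ∈ tsupport (schwartzHat φ)
      · simp [hC t ht]
      · simp [e, image_eq_zero_of_notMem_tsupport ht]
    have hi1 : Integrable (fun x => ft h x * φ x) :=
      hφi.bdd_mul (continuous_ft hh).aestronglyMeasurable (.of_forall (norm_ft_le h))
    have hi2 : Integrable (fun x => (f x - ft h x) * φ x) :=
      hφi.bdd_mul (hfc.sub (continuous_ft hh)).aestronglyMeasurable (.of_forall hfh)
    have e : ∫ x, f x * φ x = ∫ x, (f x - ft h x) * φ x := by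
      rw [← add_zero (∫ x, (f x - ft h x) * φ x), ← h0, ← integral_add hi2 hi1]
      congr 1; funext x; ring
    rw [e, ← integral_const_mul]
    refine norm_integral_le_of_norm_le (hφi.norm.const_mul ε) (.of_forall fun x => ?_)
    rw [norm_mul]
    exact mul_le_mul_of_nonneg_right (hfh x) (norm_nonneg _)
  have lim : Tendsto (fun ε : ℝ => ε * ∫ x, ‖φ x‖) (𝓝[>] 0) (𝓝 0) := by
    have : Tendsto (fun ε : ℝ => ε * ∫ x, ‖φ x‖) (𝓝 0) (𝓝 (0 * ∫ x, ‖φ x‖)) :=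
      (continuous_id.mul continuous_const).tendsto 0
    rw [zero_mul] at this
    exact this.mono_left nhdsWithin_le_nhds
  have := ge_of_tendsto lim (eventually_mem_nhdsWithin.mono fun ε hε => key ε hε)
  exact norm_le_zero_iff.1 this

/-- Modulation translates the spectrum and dilation scales it; translation by `y` only multiplies
the density by a unimodular factor. -/
theorem ApproxSpectrum.affine {K : Set ℝ} {G : ℝ → ℂ} (hG : ApproxSpectrum K G) (a y : ℝ) {N : ℝ}
    (hN : 0 < N) :
    ApproxSpectrum ((fun t => a + N * t) '' K)
      (fun x => cexp (I * a * ((x - y : ℝ) : ℂ)) * G (N * (x - y))) := by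
  intro C hC hCK ε hε
  obtain ⟨h, hh, hhC, hGh⟩ := hG ((fun t => a + N * t) ⁻¹' C) (hC.preimage (by fun_prop))
    (Set.disjoint_left.2 fun t ht hK => Set.disjoint_left.1 hCK ht ⟨t, hK, rfl⟩) ε hε
  let g : ℝ → ℂ := fun s => (N⁻¹ : ℝ) * (cexp (I * (-y : ℝ) * s) * h (N⁻¹ * (s - a)))
  have hi : Integrable fun s => h (N⁻¹ * (s - a)) :=
    (hh.comp_mul_left' (inv_ne_zero hN.ne')).comp_sub_right a
  refine ⟨g, (integrable_cexp_mul hi _).const_mul _, fun s hs => ?_, fun x => ?_⟩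
  · have : h (N⁻¹ * (s - a)) = 0 := hhC _ (by
      simpa [Set.mem_preimage, mul_inv_cancel_left₀ hN.ne'] using hs)
    simp [g, this]
  · have e : ft g x = cexp (I * a * ((x - y : ℝ) : ℂ)) * ft h (N * (x - y)) := by
      let k : ℝ → ℂ := fun t =>
        cexp (I * a * ((x - y : ℝ) : ℂ)) * (cexp (I * ((N * (x - y) : ℝ) : ℂ) * t) * h t)
      have e1 : ∀ s : ℝ, cexp (I * x * s) * g s = (N⁻¹ : ℝ) * k (N⁻¹ * (s - a)) := by
        intro s
        have hN' : (N : ℂ) ≠ 0 := by exact_mod_cast hN.ne'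
        simp only [g, k]
        rw [mul_left_comm, ← mul_assoc (cexp _) (cexp _), ← mul_assoc (cexp _) (cexp _),
          ← Complex.exp_add, ← Complex.exp_add]
        congr 3
        push_cast
        field_simp
        ring
      have e2 : ft g x = (N⁻¹ : ℝ) * ∫ s, k (N⁻¹ * (s - a)) := by
        rw [ft, ← integral_const_mul]
        exact integral_congr_ae (.of_forall e1)
      rw [e2, integral_sub_right_eq_self (fun s => k (N⁻¹ * s)) a,
        Measure.integral_comp_mul_left, inv_inv, abs_of_pos hN, Complex.real_smul, ← mul_assoc,
        ← Complex.ofReal_mul, inv_mul_cancel₀ hN.ne', Complex.ofReal_one, one_mul,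
        integral_const_mul]
      rfl
    rw [e, ← mul_sub, norm_mul, norm_cexp_I_mul_mul, one_mul]
    exact hGh _

/-! ### From spectra to the Bernstein space -/

/-- The inverse of `schwartzHat`. -/
noncomputable def schwartzHatInv : 𝓢(ℝ, ℂ) →L[ℂ] 𝓢(ℝ, ℂ) :=
  (FourierTransform.fourierCLM ℂ 𝓢(ℝ, ℂ)).comp
    (SchwartzMap.compCLMOfContinuousLinearEquiv ℂ dilation.symm)

theorem schwartzHatInv_schwartzHat (φ : 𝓢(ℝ, ℂ)) : schwartzHatInv (schwartzHat φ) = φ := by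
  have : SchwartzMap.compCLMOfContinuousLinearEquiv ℂ dilation.symm (schwartzHat φ) = 𝓕⁻ φ := by
    ext t
    simp [schwartzHat]
  simp only [schwartzHatInv, ContinuousLinearMap.comp_apply, this]
  simp

theorem schwartzHat_schwartzHatInv (φ : 𝓢(ℝ, ℂ)) : schwartzHat (schwartzHatInv φ) = φ := by
  ext t
  simp [schwartzHat, schwartzHatInv]

/-- The tempered distribution given by a bounded continuous function. -/
theorem exists_temperedDistribution (f : ℝ →ᵇ ℂ) :
    ∃ T : 𝓢'(ℝ, ℂ), ∀ φ : 𝓢(ℝ, ℂ), T φ = ∫ x, f x * φ x := by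
  have hf : MemLp f ∞ (volume : Measure ℝ) :=
    memLp_top_of_bound f.continuous.aestronglyMeasurable ‖f‖ (.of_forall f.norm_coe_le_norm)
  refine ⟨Lp.toTemperedDistribution hf.toLp, fun φ => ?_⟩
  rw [Lp.toTemperedDistribution_apply]
  refine integral_congr_ae (hf.coeFn_toLp.mono fun x hx => ?_)
  simp only [hx, smul_eq_mul, mul_comm]

/-- The distribution is `f` composed with the inverse transform on test functions. Closedness of `S`
makes it one of the sets whose intersection is the support. -/
theorem mem_bernsteinSpace {S : Set ℝ} (hS : IsClosed S) {f : ℝ →ᵇ ℂ}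
    (hf : ∀ φ : 𝓢(ℝ, ℂ), tsupport (schwartzHat φ) ⊆ Sᶜ → ∫ x, f x * φ x = 0) :
    f ∈ bernsteinSpace S := by
  obtain ⟨T, hT⟩ := exists_temperedDistribution f
  have hF : ∀ u, PointwiseConvergenceCLM.precomp ℂ schwartzHatInv T u = T (schwartzHatInv u) :=
    fun u => rfl
  refine ⟨PointwiseConvergenceCLM.precomp ℂ schwartzHatInv T, ?_, fun φ => ?_⟩
  · refine Set.sInter_subset_of_mem ⟨fun u hu => ?_, hS⟩
    rw [hF, hT]
    exact hf _ (by rwa [schwartzHat_schwartzHatInv])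
  · rw [hF, schwartzHatInv_schwartzHat, hT]


/-! ### Periodic weights of small density -/

theorem intervalIntegral_comp_natCast_mul {f : ℝ → ℝ} (hf : Function.Periodic f 1)
    (hi : ∀ a b : ℝ, IntervalIntegrable f volume a b) {q : ℕ} (hq : 1 ≤ q) :
    ∫ t in (0 : ℝ)..1, f (q * t) = ∫ t in (0 : ℝ)..1, f t := by
  have hq0 : (q : ℝ) ≠ 0 := by positivity
  have h := hf.intervalIntegral_add_zsmul_eq q 0 hi
  rw [intervalIntegral.integral_comp_mul_left _ hq0]
  simp only [zero_add, zsmul_eq_mul, Int.cast_natCast, mul_one] at h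
  rw [mul_zero, mul_one, h, smul_eq_mul, inv_mul_cancel_left₀ hq0]

theorem volume_inter_preimage_natCast_mul {A : Set ℝ} (hA : MeasurableSet A)
    (hper : ∀ t, t + 1 ∈ A ↔ t ∈ A) {q : ℕ} (hq : 1 ≤ q) :
    volume (Set.Icc (0 : ℝ) 1 ∩ (fun t : ℝ => q * t) ⁻¹' A) = volume (Set.Icc (0 : ℝ) 1 ∩ A) := by
  have hm : ∀ B : Set ℝ, MeasurableSet B →
      ∫ t in (0 : ℝ)..1, B.indicator (fun _ => (1 : ℝ)) t =
        (volume (Set.Icc (0 : ℝ) 1 ∩ B)).toReal := by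
    intro B hB
    rw [intervalIntegral.integral_of_le zero_le_one, ← integral_Icc_eq_integral_Ioc,
      setIntegral_indicator hB]
    simp [Measure.real]
  have hfin : ∀ B : Set ℝ, volume (Set.Icc (0 : ℝ) 1 ∩ B) ≠ ∞ := fun B =>
    ((measure_mono Set.inter_subset_left).trans_lt measure_Icc_lt_top).ne
  rw [← ENNReal.toReal_eq_toReal_iff' (hfin _) (hfin _), ← hm A hA, ← hm _ (hA.preimage (by fun_prop))]
  rw [← intervalIntegral_comp_natCast_mul (f := A.indicator fun _ => (1 : ℝ)) _ _ hq]
  · rfl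
  · intro t
    by_cases ht : t ∈ A
    · simp [ht, (hper t).2 ht]
    · simp [ht, mt (hper t).1 ht]
  · intro a b
    exact ⟨(integrableOn_const (by simp)).indicator hA, (integrableOn_const (by simp)).indicator hA⟩

/-- As `c` increases to 1 these sets decrease to a set of integers, which is null. -/
theorem exists_volume_cos_le {σ : ℝ≥0∞} (hσ : 0 < σ) :
    ∃ c < (1 : ℝ), volume (Set.Icc (0 : ℝ) 1 ∩ {t | c ≤ Real.cos (2 * Real.pi * t)}) ≤ σ := by
  let A : ℕ → Set ℝ := fun n =>
    Set.Icc (0 : ℝ) 1 ∩ {t | 1 - 1 / ((n : ℝ) + 1) ≤ Real.cos (2 * Real.pi * t)}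
  have hAc : ∀ n, IsClosed (A n) := fun n =>
    isClosed_Icc.inter (isClosed_le continuous_const (by fun_prop))
  have hanti : Antitone A := fun m n hmn t ht =>
    ⟨ht.1, show 1 - 1 / ((m : ℝ) + 1) ≤ _ from
      le_trans (sub_le_sub_left (Nat.one_div_le_one_div hmn) _) ht.2⟩
  have hlim := tendsto_measure_iInter_atTop (μ := volume) (s := A)
    (fun n => (hAc n).measurableSet.nullMeasurableSet) hanti
    ⟨0, ((measure_mono Set.inter_subset_left).trans_lt measure_Icc_lt_top).ne⟩
  have hnull : volume (⋂ n, A n) = 0 := by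
    refine ((Set.countable_range (fun n : ℤ => (n : ℝ))).mono fun t ht => ?_).measure_zero _
    have h1 : ∀ n : ℕ, 1 - 1 / ((n : ℝ) + 1) ≤ Real.cos (2 * Real.pi * t) := fun n =>
      (Set.mem_iInter.1 ht n).2
    have h2 : (1 : ℝ) ≤ Real.cos (2 * Real.pi * t) := by
      have hl : Tendsto (fun n : ℕ => 1 - 1 / ((n : ℝ) + 1)) atTop (𝓝 1) := by
        simpa using (tendsto_one_div_add_atTop_nhds_zero_nat (𝕜 := ℝ)).const_sub 1
      exact le_of_tendsto' hl h1
    obtain ⟨n, hn⟩ := (Real.cos_eq_one_iff _).1 (le_antisymm (Real.cos_le_one _) h2)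
    exact ⟨n, by have := Real.pi_pos; nlinarith⟩
  rw [hnull] at hlim
  obtain ⟨n, hn⟩ := ((tendsto_order.1 hlim).2 σ hσ).exists
  exact ⟨_, sub_lt_self _ Nat.one_div_pos_of_nat, hn.le⟩

/-- A `C¹` nonnegative `1`-periodic function of mean one, living on a periodic closed set of small
density. -/
theorem exists_periodic_weight {σ : ℝ≥0∞} (hσ : 0 < σ) :
    ∃ (Φ : ℝ → ℝ) (A : Set ℝ), ContDiff ℝ 1 Φ ∧ Function.Periodic Φ 1 ∧ (∀ t, 0 ≤ Φ t) ∧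
      ∫ t in (0 : ℝ)..1, Φ t = 1 ∧ IsClosed A ∧ (∀ t, t + 1 ∈ A ↔ t ∈ A) ∧
      (∀ t, t ∉ A → Φ t = 0) ∧ volume (Set.Icc (0 : ℝ) 1 ∩ A) ≤ σ := by
  obtain ⟨c, hc, hcσ⟩ := exists_volume_cos_le hσ
  let g : ℝ → ℝ := fun t => Real.smoothTransition (Real.cos (2 * Real.pi * t) - c)
  have hcosper : ∀ t, Real.cos (2 * Real.pi * (t + 1)) = Real.cos (2 * Real.pi * t) := fun t => by
    rw [mul_add, mul_one, Real.cos_add_two_pi]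
  have hg : ContDiff ℝ 1 g :=
    (Real.smoothTransition.contDiff (n := 1)).comp
      ((Real.contDiff_cos.comp (contDiff_const.mul contDiff_id)).sub contDiff_const)
  have hg0 : ∀ t, 0 ≤ g t := fun t => Real.smoothTransition.nonneg _
  have hpos : 0 < ∫ t in (0 : ℝ)..1, g t := by
    refine intervalIntegral.integral_pos zero_lt_one hg.continuous.continuousOn
      (fun t _ => hg0 t) ⟨0, by simp, Real.smoothTransition.pos_of_pos ?_⟩
    simpa using hc
  refine ⟨fun t => (∫ t in (0 : ℝ)..1, g t)⁻¹ * g t, {t | c ≤ Real.cos (2 * Real.pi * t)},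
    contDiff_const.mul hg, fun t => ?_, fun t => mul_nonneg (inv_nonneg.2 hpos.le) (hg0 t), ?_,
    isClosed_le continuous_const (by fun_prop), fun t => ?_, fun t ht => ?_, hcσ⟩
  · simp only [g, hcosper]
  · rw [intervalIntegral.integral_const_mul, inv_mul_cancel₀ hpos.ne']
  · simp only [Set.mem_ofPred_eq, hcosper]
  · simp only [g]
    rw [Real.smoothTransition.zero_of_nonpos (sub_nonpos.2 (not_le.1 ht).le), mul_zero]

/-! ### Shrinking a support at little cost to the Fourier transform -/

/-- A function of mean one oscillates to its mean: quantitative version, by integration by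
parts. -/
theorem exists_norm_ft_mul_periodic_sub_one_le {Φ : ℝ → ℝ} (hΦ : Continuous Φ)
    (hper : Function.Periodic Φ 1) (hmean : ∫ t in (0 : ℝ)..1, Φ t = 1) {h : ℝ → ℂ}
    (hh : ContDiff ℝ 1 h) (hs : HasCompactSupport h) :
    ∃ D : ℝ, ∀ q : ℕ, 1 ≤ q → ∀ x : ℝ,
      ‖ft (fun t => h t * ((Φ (q * t) : ℂ) - 1)) x‖ ≤ D * (1 + |x|) / q := by
  -- Since `Φ - 1` has mean zero, its primitive is periodic, hence bounded; integrating by parts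
  -- against `Ψ (q t) / q` gains the factor `1 / q`.
  let Ψ : ℝ → ℝ := fun s => ∫ t in (0 : ℝ)..s, (Φ t - 1)
  have hΦ1 : Continuous fun t => Φ t - 1 := hΦ.sub continuous_const
  have hΨd : ∀ s, HasDerivAt Ψ (Φ s - 1) s := fun s => (hΦ1.integral_hasStrictDerivAt 0 s).hasDerivAt
  have hΨc : Continuous Ψ := continuous_iff_continuousAt.2 fun s => (hΨd s).continuousAt
  have hint : ∀ a b : ℝ, IntervalIntegrable (fun t => Φ t - 1) volume a b :=
    fun a b => hΦ1.intervalIntegrable a b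
  have hΨp : Function.Periodic Ψ 1 := by
    intro s
    have hp : Function.Periodic (fun t => Φ t - 1) 1 := fun t => by simp only [hper t]
    have h0 : ∫ t in (0 : ℝ)..0 + 1, (Φ t - 1) = 0 := by
      rw [zero_add, intervalIntegral.integral_sub (hΦ.intervalIntegrable _ _) (by simp), hmean]
      simp
    have := hp.intervalIntegral_add_eq_add 0 s hint
    rw [h0, add_zero] at this
    exact this
  obtain ⟨B, hB⟩ := (hΨp.isBounded_of_continuous one_ne_zero hΨc).exists_norm_le
  have hB' : ∀ s, |Ψ s| ≤ B := fun s => hB _ ⟨s, rfl⟩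
  have hB0 : 0 ≤ B := (abs_nonneg _).trans (hB' 0)
  have hdc : Continuous (deriv h) := hh.continuous_deriv le_rfl
  have hhi : Integrable h := hh.continuous.integrable_of_hasCompactSupport hs
  have hdi : Integrable (deriv h) := hdc.integrable_of_hasCompactSupport hs.deriv
  refine ⟨B * ((∫ t, ‖h t‖) + ∫ t, ‖deriv h t‖), fun q hq x => ?_⟩
  have hq0 : (0 : ℝ) < q := by exact_mod_cast hq
  let e : ℝ → ℂ := fun t => cexp (I * x * t)
  let u : ℝ → ℂ := fun t => e t * h t
  let u' : ℝ → ℂ := fun t => e t * (I * x) * h t + e t * deriv h t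
  let v : ℝ → ℂ := fun t => ((Ψ (q * t) / q : ℝ) : ℂ)
  let v' : ℝ → ℂ := fun t => ((Φ (q * t) - 1 : ℝ) : ℂ)
  have hec : Continuous e := by fun_prop
  have hu : ∀ t, HasDerivAt u (u' t) t := by
    intro t
    have h1 : HasDerivAt (fun t : ℝ => I * x * (t : ℂ)) (I * x) t := by
      simpa using (Complex.ofRealCLM.hasDerivAt (x := t)).const_mul (I * (x : ℂ))
    exact h1.cexp.mul ((hh.differentiable one_ne_zero) t).hasDerivAt
  have hv : ∀ t, HasDerivAt v (v' t) t := by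
    intro t
    refine HasDerivAt.ofReal_comp ?_
    have h1 : HasDerivAt (fun t : ℝ => (q : ℝ) * t) q t := by
      simpa using (hasDerivAt_id t).const_mul (q : ℝ)
    have h2 := ((hΨd (q * t)).comp t h1).div_const (q : ℝ)
    rwa [mul_div_cancel_right₀ _ hq0.ne'] at h2
  have hvc : Continuous v := by fun_prop
  have hv'c : Continuous v' := by fun_prop
  have hu'c : Continuous u' := ((hec.mul continuous_const).mul hh.continuous).add (hec.mul hdc)
  have hus : HasCompactSupport u := hs.mul_left
  have hu's : HasCompactSupport u' := HasCompactSupport.add hs.mul_left hs.deriv.mul_left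
  have hu'i : Integrable u' := hu'c.integrable_of_hasCompactSupport hu's
  have key := integral_mul_deriv_eq_deriv_mul_of_integrable (u := u) (v := v) (u' := u') (v' := v')
    (fun t _ => hu t) (fun t _ => hv t)
    (((hec.mul hh.continuous).mul hv'c).integrable_of_hasCompactSupport hus.mul_right)
    ((hu'c.mul hvc).integrable_of_hasCompactSupport hu's.mul_right)
    (((hec.mul hh.continuous).mul hvc).integrable_of_hasCompactSupport hus.mul_right)
  have e1 : ft (fun t => h t * ((Φ (q * t) : ℂ) - 1)) x = ∫ t, u t * v' t := by
    refine integral_congr_ae (.of_forall fun t => ?_)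
    simp only [u, v', e]
    push_cast
    ring
  have hvb : ∀ t, ‖v t‖ ≤ B / q := fun t => by
    simp only [v, Complex.norm_real, Real.norm_eq_abs, abs_div, abs_of_pos hq0]
    exact div_le_div_of_nonneg_right (hB' _) hq0.le
  have hu'b : ∀ t, ‖u' t‖ ≤ |x| * ‖h t‖ + ‖deriv h t‖ := fun t => by
    refine (norm_add_le _ _).trans_eq ?_
    simp [e, norm_cexp_I_mul_mul]
  have hi1 : Integrable fun t => |x| * ‖h t‖ + ‖deriv h t‖ := (hhi.norm.const_mul _).add hdi.norm
  rw [e1, key, norm_neg]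
  have hbound : ‖∫ t, u' t * v t‖ ≤ ∫ t, (|x| * ‖h t‖ + ‖deriv h t‖) * (B / q) := by
    refine norm_integral_le_of_norm_le (hi1.mul_const _) (.of_forall fun t => ?_)
    rw [norm_mul]
    exact mul_le_mul (hu'b t) (hvb t) (norm_nonneg _) (by positivity)
  refine hbound.trans ?_
  rw [integral_mul_const, integral_add (hhi.norm.const_mul _) hdi.norm, integral_const_mul]
  have a0 : 0 ≤ ∫ t, ‖h t‖ := integral_nonneg fun _ => norm_nonneg _
  have b0 : 0 ≤ ∫ t, ‖deriv h t‖ := integral_nonneg fun _ => norm_nonneg _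
  rw [mul_div_assoc', mul_comm]
  refine div_le_div_of_nonneg_right ?_ hq0.le
  rw [mul_assoc]
  refine mul_le_mul_of_nonneg_left ?_ hB0
  nlinarith [abs_nonneg x]

/-- The gliding hump: functions vanishing at infinity which tend to zero locally uniformly have a
subsequence whose members are essentially disjoint, so that their means are small. -/
theorem exists_norm_sum_range_le {E : ℕ → ℝ → ℂ} (h0 : ∀ q, Tendsto (E q) (cocompact ℝ) (𝓝 0))
    {D : ℝ} (hD : ∀ q : ℕ, 1 ≤ q → ∀ x, ‖E q x‖ ≤ D * (1 + |x|) / q) {M : ℝ}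
    (hM : ∀ q : ℕ, 1 ≤ q → ∀ x, ‖E q x‖ ≤ M) (m : ℕ) {ε : ℝ} (hε : 0 < ε) :
    ∃ q : ℕ → ℕ, (∀ i, 1 ≤ q i) ∧
      ∀ x, ‖∑ i ∈ Finset.range m, E (q i) x‖ ≤ M + m * ε := by
  have hD0 : 0 ≤ D := by simpa using (norm_nonneg _).trans (hD 1 le_rfl 0)
  -- `E p` is small outside some `[-X, X]`, and the `1 / q` bound makes `E q` small inside it for
  -- large `q`.
  have hpair : ∀ p : ℕ, ∀ᶠ q : ℕ in atTop, ∀ x, ‖E p x‖ ≤ ε ∨ ‖E q x‖ ≤ ε := by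
    intro p
    have h1 : ∀ᶠ x in cocompact ℝ, ‖E p x‖ < ε := by
      simpa using (h0 p).eventually (Metric.ball_mem_nhds 0 hε)
    obtain ⟨X, hX⟩ : ∃ X : ℝ, ∀ x, X < |x| → ‖E p x‖ ≤ ε := by
      rw [← Metric.cobounded_eq_cocompact, ← comap_norm_atTop, eventually_comap] at h1
      obtain ⟨X, hX⟩ := eventually_atTop.1 h1
      exact ⟨X, fun x hx => (hX |x| hx.le x rfl).le⟩
    have h2 : Tendsto (fun q : ℕ => D * (1 + X) / (q : ℝ)) atTop (𝓝 0) :=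
      tendsto_const_div_atTop_nhds_zero_nat _
    filter_upwards [h2.eventually (ge_mem_nhds hε), eventually_ge_atTop 1] with q hq hq1 x
    by_cases hx : X < |x|
    · exact Or.inl (hX x hx)
    · refine Or.inr ((hD q hq1 x).trans (le_trans ?_ hq))
      gcongr
      exact not_lt.1 hx
  obtain ⟨q, hq1, hq⟩ := exists_seq_of_forall_finset_exists (fun q : ℕ => 1 ≤ q)
    (fun p q => ∀ x, ‖E p x‖ ≤ ε ∨ ‖E q x‖ ≤ ε) (by
      intro s _
      exact ((eventually_ge_atTop 1).and
        ((Filter.eventually_all_finset s).2 fun p _ => hpair p)).exists)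
  refine ⟨q, hq1, fun x => ?_⟩
  have hM0 : 0 ≤ M := (norm_nonneg _).trans (hM 1 le_rfl 0)
  -- At each `x` at most one term exceeds `ε`; it costs `M`.
  by_cases hall : ∀ i ∈ Finset.range m, ‖E (q i) x‖ ≤ ε
  · refine (norm_sum_le_of_le _ hall).trans ?_
    simpa using hM0
  · push Not at hall
    obtain ⟨i, hi, hix⟩ := hall
    rw [← Finset.add_sum_erase _ _ hi]
    refine (norm_add_le _ _).trans (add_le_add (hM _ (hq1 i) x) ?_)
    have hle : ∀ j ∈ (Finset.range m).erase i, ‖E (q j) x‖ ≤ ε := by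
      intro j hj
      rcases lt_or_gt_of_ne (Finset.ne_of_mem_erase hj) with hlt | hlt
      · exact (hq j i hlt x).resolve_right (not_le.2 hix)
      · exact (hq i j hlt x).resolve_left (not_le.2 hix)
    refine (norm_sum_le_of_le _ hle).trans ?_
    rw [Finset.sum_const, nsmul_eq_mul]
    have : ((Finset.range m).erase i).card ≤ m := by
      simpa using Finset.card_le_card (Finset.erase_subset i (Finset.range m))
    gcongr

/-- A `C¹` function supported in `[0, 1]` can be modified so that its support becomes small,
whereas its Fourier transform hardly changes. -/
theorem exists_small_support_ft_close {h : ℝ → ℂ} (hh : ContDiff ℝ 1 h)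
    (hs : tsupport h ⊆ Set.Icc 0 1) {ε : ℝ} (hε : 0 < ε) {η : ℝ≥0∞} (hη : 0 < η) :
    ∃ g : ℝ → ℂ, ContDiff ℝ 1 g ∧ tsupport g ⊆ tsupport h ∧ volume (tsupport g) ≤ η ∧
      ∀ x, ‖ft h x - ft g x‖ ≤ ε := by
  have hcs : HasCompactSupport h := isCompact_Icc.of_isClosed_subset (isClosed_tsupport h) hs
  have hhi : Integrable h := hh.continuous.integrable_of_hasCompactSupport hcs
  obtain ⟨H, hH⟩ := hcs.exists_bound_of_continuous hh.continuous
  have hH0 : 0 ≤ H := (norm_nonneg _).trans (hH 0)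
  -- Here `2 * H` will bound every error, so averaging `m` of them leaves less than `ε / 2` from the
  -- exceptional term.
  obtain ⟨m, hm⟩ := exists_nat_gt (2 * H / (ε / 2))
  have hm0 : (0 : ℝ) < m := lt_of_le_of_lt (by positivity) hm
  obtain ⟨Φ, A, hΦ, hper, hΦ0, hmean, hA, hAper, hΦA, hvol⟩ :=
    exists_periodic_weight (ENNReal.div_pos hη.ne' (ENNReal.natCast_ne_top m))
  have hΦc := hΦ.continuous
  let E : ℕ → ℝ → ℂ := fun q => ft (fun t => h t * ((Φ (q * t) : ℂ) - 1))
  obtain ⟨D, hD⟩ := exists_norm_ft_mul_periodic_sub_one_le hΦc hper hmean hh hcs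
  -- Only the mean of `Φ` enters, not its maximum. The bound is thus independent of `Φ`, whose
  -- density `η / m` was fixed after `m`.
  have hM : ∀ q : ℕ, 1 ≤ q → ∀ x, ‖E q x‖ ≤ 2 * H := by
    intro q hq x
    refine (norm_ft_le _ _).trans ?_
    have hi : IntegrableOn (fun t => H * (Φ (q * t) + 1)) (Set.Icc 0 1) volume :=
      (by fun_prop : Continuous fun t => H * (Φ (q * t) + 1)).integrableOn_Icc
    have hval : ∫ t in Set.Icc (0 : ℝ) 1, H * (Φ (q * t) + 1) = 2 * H := by
      rw [integral_Icc_eq_integral_Ioc, ← intervalIntegral.integral_of_le zero_le_one,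
        intervalIntegral.integral_const_mul, intervalIntegral.integral_add
          ((by fun_prop : Continuous fun t => Φ (q * t)).intervalIntegrable _ _) (by simp),
        intervalIntegral_comp_natCast_mul hper (fun a b => hΦc.intervalIntegrable a b) hq, hmean]
      simp
      ring
    rw [← hval, ← integral_indicator measurableSet_Icc]
    refine integral_mono_of_nonneg (.of_forall fun t => norm_nonneg _)
      ((integrable_indicator_iff measurableSet_Icc).2 hi) (.of_forall fun t => ?_)
    by_cases ht : t ∈ Set.Icc (0 : ℝ) 1
    · simp only [Set.indicator_of_mem ht, norm_mul]
      refine mul_le_mul (hH t) ((norm_sub_le _ _).trans_eq ?_) (norm_nonneg _) hH0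
      simp [abs_of_nonneg (hΦ0 _)]
    · simp [Set.indicator_of_notMem ht, image_eq_zero_of_notMem_tsupport (fun h => ht (hs h))]
  obtain ⟨q, hq1, hq⟩ := exists_norm_sum_range_le (fun q => tendsto_ft_cocompact _) hD hM m
    (half_pos hε)
  let w : ℝ → ℝ := fun t => (m : ℝ)⁻¹ * ∑ i ∈ Finset.range m, Φ (q i * t)
  have hw : ContDiff ℝ 1 w := contDiff_const.mul
    (ContDiff.sum fun i _ => hΦ.comp (contDiff_const.mul contDiff_id))
  let g : ℝ → ℂ := fun t => h t * (w t : ℂ)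
  have hg : ContDiff ℝ 1 g := hh.mul (Complex.ofRealCLM.contDiff.comp hw)
  have hgh : tsupport g ⊆ tsupport h := closure_mono (Function.support_mul_subset_left _ _)
  refine ⟨g, hg, hgh, ?_, fun x => ?_⟩
  · have hsub : tsupport g ⊆
        ⋃ i ∈ Finset.range m, Set.Icc (0 : ℝ) 1 ∩ (fun t : ℝ => q i * t) ⁻¹' A := by
      have hcl : IsClosed (⋃ i ∈ Finset.range m, (fun t : ℝ => (q i : ℝ) * t) ⁻¹' A) :=
        isClosed_biUnion_finset fun i _ => hA.preimage (by fun_prop)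
      have hsg : tsupport g ⊆ ⋃ i ∈ Finset.range m, (fun t : ℝ => (q i : ℝ) * t) ⁻¹' A := by
        refine closure_minimal (fun t ht => ?_) hcl
        by_contra hn
        simp only [Set.mem_iUnion, not_exists] at hn
        refine ht ?_
        have : w t = 0 := by
          simp only [w]
          rw [Finset.sum_eq_zero fun i hi => hΦA _ (hn i hi), mul_zero]
        simp [g, this]
      intro t ht
      obtain ⟨i, hi, hti⟩ := Set.mem_iUnion₂.1 (hsg ht)
      exact Set.mem_iUnion₂.2 ⟨i, hi, hs (hgh ht), hti⟩
    refine (measure_mono hsub).trans ((measure_biUnion_finset_le _ _).trans ?_)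
    refine (Finset.sum_le_sum fun i _ =>
      (volume_inter_preimage_natCast_mul hA.measurableSet hAper (hq1 i)).trans_le hvol).trans ?_
    rw [Finset.sum_const, Finset.card_range, nsmul_eq_mul]
    exact ENNReal.mul_div_le
  · have hgi : Integrable g := hg.continuous.integrable_of_hasCompactSupport hcs.mul_right
    have hEi : ∀ i, Integrable fun t => h t * ((Φ (q i * t) : ℂ) - 1) := fun i =>
      (hh.continuous.mul (by fun_prop)).integrable_of_hasCompactSupport hcs.mul_right
    have e : ft g x - ft h x = (m : ℂ)⁻¹ * ∑ i ∈ Finset.range m, E (q i) x := by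
      rw [← ft_sub hgi hhi]
      simp only [E, ft]
      rw [← integral_finsetSum _ fun i _ => integrable_cexp_mul (hEi i) x, ← integral_const_mul]
      refine integral_congr_ae (.of_forall fun t => ?_)
      have hm' : (m : ℂ) ≠ 0 := by exact_mod_cast hm0.ne'
      simp only [g, w, ← Finset.mul_sum, Finset.sum_sub_distrib, Finset.sum_const,
        Finset.card_range, nsmul_eq_mul]
      push_cast
      generalize ∑ i ∈ Finset.range m, (Φ (q i * t) : ℂ) = s
      field_simp
    rw [norm_sub_rev, e, norm_mul, norm_inv, Complex.norm_natCast, inv_mul_le_iff₀ hm0]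
    refine (hq x).trans ?_
    rw [div_lt_iff₀ (half_pos hε)] at hm
    linarith


/-! ### Menshov's construction -/

theorem ApproxSpectrum.const_mul {K : Set ℝ} {f : ℝ → ℂ} (hf : ApproxSpectrum K f) (c : ℂ) :
    ApproxSpectrum K (fun x => c * f x) := by
  intro C hC hCK ε hε
  obtain ⟨h, hh, hhC, hfh⟩ := hf C hC hCK (ε / (‖c‖ + 1)) (by positivity)
  refine ⟨fun t => c * h t, hh.const_mul c, fun t ht => by simp [hhC t ht], fun x => ?_⟩
  have e : ft (fun t => c * h t) x = c * ft h x := by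
    simp only [ft, ← integral_const_mul]
    congr 1; funext t; ring
  rw [e, ← mul_sub, norm_mul]
  refine (mul_le_mul_of_nonneg_left (hfh x) (norm_nonneg c)).trans ?_
  rw [mul_div_assoc', div_le_iff₀ (by positivity)]
  nlinarith

theorem ApproxSpectrum.mono {K L : Set ℝ} {f : ℝ → ℂ} (hf : ApproxSpectrum K f) (hKL : K ⊆ L) :
    ApproxSpectrum L f :=
  fun C hC hCL => hf C hC (hCL.mono_right hKL)

/-- Menshov's theorem in the form: there is a function tending to zero at infinity, not
vanishing at the origin, whose spectrum is a compact null set. -/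
theorem exists_null_spectrum_tendsto_zero :
    ∃ (K : Set ℝ) (G : ℝ → ℂ), K ⊆ Set.Icc 0 1 ∧ IsClosed K ∧ volume K = 0 ∧ Continuous G ∧
      G 0 = 1 ∧ Tendsto G (cocompact ℝ) (𝓝 0) ∧ ApproxSpectrum K G := by
  let P := {h : ℝ → ℂ // ContDiff ℝ 1 h ∧ tsupport h ⊆ Set.Icc 0 1}
  -- The errors sum to 1/2, below the initial value 1 at the origin, so the limit does not vanish
  -- there. For `n = 0` the volume bound is `∞`.
  have hstep : ∀ (n : ℕ) (h : P), ∃ g : P, tsupport g.1 ⊆ tsupport h.1 ∧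
      volume (tsupport g.1) ≤ (n : ℝ≥0∞)⁻¹ ∧
      ∀ x, dist (ft h.1 x) (ft g.1 x) ≤ 1 / 2 / 2 / 2 ^ n := by
    intro n h
    obtain ⟨g, hg, hgh, hvol, hclose⟩ := exists_small_support_ft_close h.2.1 h.2.2
      (ε := 1 / 2 / 2 / 2 ^ n) (by positivity) (ENNReal.inv_pos.2 (ENNReal.natCast_ne_top n))
    exact ⟨⟨g, hg, hgh.trans h.2.2⟩, hgh, hvol, fun x => (dist_eq_norm _ _).trans_le (hclose x)⟩
  choose step hsub hvol hclose using hstep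
  let b : ContDiffBump (1 / 2 : ℝ) := ⟨1 / 4, 1 / 2, by norm_num, by norm_num⟩
  let h0 : P := ⟨fun t => (b.normed volume t : ℂ), Complex.ofRealCLM.contDiff.comp b.contDiff_normed,
    by
      have h1 : tsupport (b.normed volume) ⊆ Set.Icc 0 1 := by
        rw [b.tsupport_normed_eq, Real.closedBall_eq_Icc]
        norm_num [b]
      refine (closure_mono fun t ht => ?_).trans h1
      simpa using ht⟩
  let F : ℕ → P := fun n => Nat.rec h0 step n
  have hF : ∀ n, F (n + 1) = step n (F n) := fun n => rfl
  have hFi : ∀ n, Integrable (F n).1 := fun n =>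
    (F n).2.1.continuous.integrable_of_hasCompactSupport
      (isCompact_Icc.of_isClosed_subset (isClosed_tsupport _) (F n).2.2)
  have hFd : ∀ x n, dist (ft (F n).1 x) (ft (F (n + 1)).1 x) ≤ 1 / 2 / 2 / 2 ^ n :=
    fun x n => hclose n (F n) x
  choose G hG using fun x => cauchySeq_tendsto_of_complete (cauchySeq_of_le_geometric_two (hFd x))
  have hGd : ∀ x n, dist (ft (F n).1 x) (G x) ≤ 1 / 2 / 2 ^ n := fun x n =>
    dist_le_of_le_geometric_two_of_tendsto (hFd x) (hG x) n
  have hpow : Tendsto (fun n : ℕ => (1 : ℝ) / 2 / 2 ^ n) atTop (𝓝 0) := by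
    have := (tendsto_pow_atTop_nhds_zero_of_lt_one (r := (1 / 2 : ℝ)) (by norm_num)
      (by norm_num)).const_mul (1 / 2)
    rw [mul_zero] at this
    refine this.congr fun n => ?_
    rw [one_div_pow, ← div_eq_mul_one_div]
  have hunif : TendstoUniformly (fun n => ft (F n).1) G atTop := by
    refine Metric.tendstoUniformly_iff.2 fun ε hε => ?_
    filter_upwards [hpow.eventually_lt_const hε] with n hn x
    rw [dist_comm]
    exact (hGd x n).trans_lt hn
  have hGc : Continuous G :=
    hunif.continuous (Frequently.of_forall fun n => continuous_ft (hFi n))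
  have hG0 : G 0 ≠ 0 := by
    intro h
    have h1 := hGd 0 0
    have h2 : ft (F 0).1 0 = 1 := by
      change ft (fun t => (b.normed volume t : ℂ)) 0 = 1
      simp only [ft, Complex.ofReal_zero, mul_zero, zero_mul, Complex.exp_zero, one_mul]
      rw [integral_complex_ofReal, b.integral_normed, Complex.ofReal_one]
    rw [h, h2] at h1
    norm_num at h1
  have hGlim : Tendsto G (cocompact ℝ) (𝓝 0) := by
    refine Metric.tendsto_nhds.2 fun ε hε => ?_
    obtain ⟨n, hn⟩ := (hpow.eventually_lt_const (half_pos hε)).exists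
    filter_upwards [Metric.tendsto_nhds.1 (tendsto_ft_cocompact (F n).1) _ (half_pos hε)] with x hx
    have := dist_triangle_left (G x) 0 (ft (F n).1 x)
    linarith [hGd x n]
  let K : Set ℝ := ⋂ n, tsupport (F n).1
  have hanti : Antitone fun n => tsupport (F n).1 := antitone_nat_of_succ_le fun n => hsub n (F n)
  have hK : ApproxSpectrum K G := by
    intro C hC hCK ε hε
    -- By compactness, decreasing supports whose intersection misses `C` eventually miss `C`
    -- themselves.
    obtain ⟨n, hn⟩ : ∃ n, ¬ (tsupport (F n).1 ∩ C).Nonempty := by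
      by_contra! hall
      obtain ⟨t, ht⟩ := IsCompact.nonempty_iInter_of_sequence_nonempty_isCompact_isClosed
        (fun n => tsupport (F n).1 ∩ C) (fun n => Set.inter_subset_inter_left _ (hanti n.le_succ))
        hall (isCompact_Icc.of_isClosed_subset ((isClosed_tsupport _).inter hC)
          (Set.inter_subset_left.trans (F 0).2.2)) fun n => (isClosed_tsupport _).inter hC
      rw [Set.mem_iInter] at ht
      exact Set.disjoint_left.1 hCK (ht 0).2 (Set.mem_iInter.2 fun n => (ht n).1)
    obtain ⟨k, hk, hkn⟩ := ((hpow.eventually_lt_const hε).and (eventually_ge_atTop n)).exists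
    refine ⟨(F k).1, hFi k, fun t ht => ?_, fun x => ?_⟩
    · exact image_eq_zero_of_notMem_tsupport fun htk => hn ⟨t, hanti hkn htk, ht⟩
    · rw [← dist_eq_norm, dist_comm]
      exact (hGd x k).trans hk.le
  refine ⟨K, fun x => (G 0)⁻¹ * G x, (Set.iInter_subset _ 0).trans (F 0).2.2,
    isClosed_iInter fun n => isClosed_tsupport _, ?_, continuous_const.mul hGc,
    inv_mul_cancel₀ hG0, by simpa using hGlim.const_mul (G 0)⁻¹, hK.const_mul _⟩
  refine le_antisymm (ge_of_tendsto' ENNReal.tendsto_inv_nat_nhds_zero fun n => ?_) zero_le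
  exact (measure_mono (Set.iInter_subset _ (n + 1))).trans (hvol n (F n))


/-! ### Interpolation from peaks -/

/-- A linear lift which interpolates approximately yields exact interpolation. -/
theorem isInterpolationSet_of_approx {S Λ : Set ℝ}
    (T : lp (fun _ : Λ => ℂ) ∞ →ₗ[ℂ] bernsteinSpace S)
    (hT : ∀ d, ‖d - restriction S Λ (T d)‖ ≤ 1 / 2 * ‖d‖) : IsInterpolationSet S Λ := by
  let E : lp (fun _ : Λ => ℂ) ∞ →ₗ[ℂ] lp (fun _ : Λ => ℂ) ∞ :=
    LinearMap.id - (restriction S Λ).comp T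
  have hE : ∀ d, E d = d - restriction S Λ (T d) := fun d => by
    simp only [E, LinearMap.sub_apply, LinearMap.id_apply, LinearMap.comp_apply]
  have hE2 : ∀ d, ‖E d‖ ≤ 1 / 2 * ‖d‖ := fun d => by rw [hE]; exact hT d
  let R : lp (fun _ : Λ => ℂ) ∞ →L[ℂ] lp (fun _ : Λ => ℂ) ∞ := E.mkContinuous (1 / 2) hE2
  have hRE : ∀ d, R d = E d := fun d => E.mkContinuous_apply _ hE2 d
  have hR : ‖R‖ < 1 := (E.mkContinuous_norm_le (by norm_num) hE2).trans_lt (by norm_num)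
  -- `1 - R` is restriction after `T`, invertible by the Neumann series.
  obtain ⟨U, hU⟩ := isUnit_one_sub_of_norm_lt_one hR
  intro c
  refine ⟨T ((↑U⁻¹ : lp (fun _ : Λ => ℂ) ∞ →L[ℂ] lp (fun _ : Λ => ℂ) ∞) c), ?_⟩
  have h1 : (1 - R) ((↑U⁻¹ : lp (fun _ : Λ => ℂ) ∞ →L[ℂ] lp (fun _ : Λ => ℂ) ∞) c) = c := by
    rw [← hU, ← mul_apply_eq_comp, Units.mul_inv, one_apply_eq_self]
  have h2 : ∀ d, (1 - R) d = restriction S Λ (T d) := fun d => by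
    rw [sub_apply, one_apply_eq_self, hRE, hE, sub_sub_cancel]
  rw [← h2, h1]

/-- Functions with spectrum in `S` peaking at the points of a separated set `Λ`, with summable
errors away from the peaks, make `Λ` an interpolation set. -/
theorem isInterpolationSet_of_peaks {S Λ : Set ℝ} (hS : IsClosed S) [Countable Λ] {δ : ℝ}
    (hδ : 0 < δ) (hΛ : ∀ x ∈ Λ, ∀ y ∈ Λ, x ≠ y → δ ≤ |x - y|) {f : Λ → ℝ → ℂ} {B : ℝ}
    {ε : Λ → ℝ} (hf : ∀ y, Continuous (f y)) (hspec : ∀ y, ApproxSpectrum S (f y))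
    (hB : ∀ y x, ‖f y x‖ ≤ B) (hone : ∀ y : Λ, f y y = 1)
    (hfar : ∀ (y : Λ) (x : ℝ), δ / 4 ≤ |x - y| → ‖f y x‖ ≤ ε y) (hε0 : ∀ y, 0 ≤ ε y)
    (hε : Summable ε) (hε2 : ∑' y, ε y ≤ 1 / 2) : IsInterpolationSet S Λ := by
  classical
  rcases isEmpty_or_nonempty Λ with hemp | ⟨⟨y₀⟩⟩
  · intro c
    exact ⟨0, by ext y; exact hemp.elim y⟩
  have hB0 : 0 ≤ B := (norm_nonneg _).trans (hB y₀ 0)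
  -- At most one point of `Λ` is within `δ / 2` of `x`. All other peaks stay at distance over `δ /
  -- 4` when `x` moves by less than `δ / 4`, so `ε + v x` is a locally uniform summable majorant.
  let v : ℝ → Λ → ℝ := fun x y => if |x - y| < δ / 2 then B else 0
  have hvsum : ∀ x, ∃ s ≤ B, HasSum (v x) s := by
    intro x
    by_cases hx : ∃ y : Λ, |x - y| < δ / 2
    · obtain ⟨y, hy⟩ := hx
      refine ⟨v x y, by simp [v, hy], hasSum_single y fun z hz => if_neg fun hzx => ?_⟩
      have h1 := hΛ z z.2 y y.2 (fun h => hz (Subtype.ext h))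
      have h2 := abs_sub_le (z : ℝ) x y
      rw [abs_sub_comm (z : ℝ) x] at h2
      linarith
    · push Not at hx
      refine ⟨0, hB0, ?_⟩
      have : v x = fun _ => 0 := funext fun y => if_neg (not_lt.2 (hx y))
      rw [this]
      exact hasSum_zero
  let u : ℝ → Λ → ℝ := fun x y => ε y + v x y
  have husum : ∀ x, Summable (u x) := fun x => by
    obtain ⟨s, -, hs⟩ := hvsum x
    exact hε.add hs.summable
  have hutsum : ∀ x, ∑' y, u x y ≤ 1 / 2 + B := fun x => by
    obtain ⟨s, hsB, hs⟩ := hvsum x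
    rw [hε.tsum_add hs.summable, hs.tsum_eq]
    exact add_le_add hε2 hsB
  have hfu : ∀ x₀ x y, |x - x₀| < δ / 4 → ‖f y x‖ ≤ u x₀ y := by
    intro x₀ x y hx
    by_cases hy : |x₀ - y| < δ / 2
    · simp only [u, v, if_pos hy]
      exact (hB y x).trans (le_add_of_nonneg_left (hε0 y))
    · simp only [u, v, if_neg hy, add_zero]
      refine hfar y x ?_
      have h2 := abs_sub_le x₀ x y
      rw [abs_sub_comm x₀ x] at h2
      linarith
  have hfu' : ∀ x y, ‖f y x‖ ≤ u x y := fun x y => hfu x x y (by simpa using hδ)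
  have hd : ∀ (d : lp (fun _ : Λ => ℂ) ∞) y, ‖d y‖ ≤ ‖d‖ :=
    fun d y => lp.norm_apply_le_norm ENNReal.top_ne_zero d y
  have hdfu : ∀ (d : lp (fun _ : Λ => ℂ) ∞) x₀ x y, |x - x₀| < δ / 4 →
      ‖d y * f y x‖ ≤ ‖d‖ * u x₀ y := fun d x₀ x y hx => by
    rw [norm_mul]
    exact mul_le_mul (hd d y) (hfu x₀ x y hx) (norm_nonneg _) (norm_nonneg _)
  have hdfu' : ∀ (d : lp (fun _ : Λ => ℂ) ∞) x y, ‖d y * f y x‖ ≤ ‖d‖ * u x y :=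
    fun d x y => hdfu d x x y (by simpa using hδ)
  have hsum : ∀ (d : lp (fun _ : Λ => ℂ) ∞) x, Summable fun y => d y * f y x := fun d x =>
    .of_norm_bounded ((husum x).mul_left ‖d‖) (hdfu' d x)
  have hcont : ∀ d : lp (fun _ : Λ => ℂ) ∞, Continuous fun x => ∑' y, d y * f y x := by
    intro d
    refine continuous_iff_continuousAt.2 fun x₀ => ?_
    refine (continuousOn_tsum (s := Metric.ball x₀ (δ / 4))
      (fun y => (continuous_const.mul (hf y)).continuousOn) ((husum x₀).mul_left ‖d‖)
      fun y x hx => hdfu d x₀ x y ?_).continuousAt (Metric.ball_mem_nhds _ (by positivity))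
    rwa [Metric.mem_ball, Real.dist_eq] at hx
  let F : lp (fun _ : Λ => ℂ) ∞ → ℝ →ᵇ ℂ := fun d =>
    BoundedContinuousFunction.ofNormedAddCommGroup (fun x => ∑' y, d y * f y x) (hcont d)
      (‖d‖ * (1 / 2 + B)) fun x => by
        refine (tsum_of_norm_bounded ((husum x).mul_left ‖d‖).hasSum (hdfu' d x)).trans ?_
        rw [tsum_mul_left]
        exact mul_le_mul_of_nonneg_left (hutsum x) (norm_nonneg _)
  have hFx : ∀ d x, F d x = ∑' y, d y * f y x := fun d x => rfl
  have hmem : ∀ d, F d ∈ bernsteinSpace S := by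
    intro d
    refine mem_bernsteinSpace hS fun φ hφ => ?_
    have hφi : Integrable (φ : ℝ → ℂ) := φ.integrable
    -- Termwise integration: each peak annihilates `φ`, hence so does the sum.
    have key := hasSum_integral_of_dominated_convergence (μ := volume)
      (F := fun (y : Λ) (x : ℝ) => d y * f y x * φ x) (f := fun x => F d x * φ x)
      (fun y x => ‖d y * f y x‖ * ‖φ x‖)
      (fun y => ((continuous_const.mul (hf y)).mul φ.continuous).aestronglyMeasurable)
      (fun y => .of_forall fun x => (norm_mul _ _).le)
      (.of_forall fun x => (hsum d x).norm.mul_right _) ?_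
      (.of_forall fun x => (hsum d x).hasSum.mul_right _)
    · refine key.unique ?_
      have : (fun y : Λ => ∫ x, d y * f y x * φ x) = fun _ => 0 := by
        funext y
        simp only [mul_assoc]
        rw [integral_const_mul, (hspec y).integral_mul_eq_zero (hf y) hφ, mul_zero]
      rw [this]
      exact hasSum_zero
    · have hmeas : AEStronglyMeasurable (fun x => ∑' y, ‖d y * f y x‖ * ‖φ x‖) volume := by
        refine (Measurable.tsum fun y => ?_).aestronglyMeasurable
        exact ((continuous_const.mul (hf y)).norm.mul φ.continuous.norm).measurable
      refine (hφi.norm.const_mul (‖d‖ * (1 / 2 + B))).mono' hmeas (.of_forall fun x => ?_)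
      rw [tsum_mul_right, Real.norm_of_nonneg (by positivity)]
      refine mul_le_mul_of_nonneg_right ?_ (norm_nonneg _)
      refine ((hsum d x).norm.tsum_le_tsum (hdfu' d x) ((husum x).mul_left _)).trans ?_
      rw [tsum_mul_left]
      exact mul_le_mul_of_nonneg_left (hutsum x) (norm_nonneg _)
  let T : lp (fun _ : Λ => ℂ) ∞ →ₗ[ℂ] bernsteinSpace S :=
    { toFun := fun d => ⟨F d, hmem d⟩
      map_add' := fun c d => by
        refine Subtype.ext (BoundedContinuousFunction.ext fun x => ?_)
        simp only [Submodule.coe_add, BoundedContinuousFunction.add_apply, hFx]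
        rw [← (hsum c x).tsum_add (hsum d x)]
        exact tsum_congr fun y => add_mul _ _ _
      map_smul' := fun a d => by
        refine Subtype.ext (BoundedContinuousFunction.ext fun x => ?_)
        simp only [Submodule.coe_smul, BoundedContinuousFunction.smul_apply, hFx, smul_eq_mul,
          RingHom.id_apply]
        rw [← tsum_mul_left]
        exact tsum_congr fun y => mul_assoc _ _ _ }
  refine isInterpolationSet_of_approx T fun d => ?_
  refine lp.norm_le_of_forall_le (by positivity) fun z => ?_
  have e : (d - restriction S Λ (T d)) z = d z - ∑' y, d y * f y z := rfl
  -- The diagonal term reproduces `d z`; the remaining peaks contribute at most `‖d‖ * ∑ ε`.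
  rw [e, (hsum d z).tsum_eq_add_tsum_ite z, hone, mul_one, sub_add_cancel_left, norm_neg]
  refine (tsum_of_norm_bounded (hε.mul_left ‖d‖).hasSum fun y => ?_).trans ?_
  · split_ifs with hyz
    · simpa using mul_nonneg (norm_nonneg d) (hε0 y)
    · rw [norm_mul]
      refine mul_le_mul (hd d y) (hfar y z ?_) (norm_nonneg _) (norm_nonneg _)
      have := hΛ z z.2 y y.2 fun h => hyz (Subtype.ext h.symm)
      linarith
  · rw [tsum_mul_left, mul_comm]
    exact mul_le_mul_of_nonneg_right hε2 (norm_nonneg _)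

theorem UniformlyDiscrete.countable {Λ : Set ℝ} (h : UniformlyDiscrete Λ) : Countable Λ := by
  obtain ⟨δ, hδ, hΛ⟩ := h
  refine Function.Injective.countable (f := fun y : Λ => ⌊(y : ℝ) / δ⌋) fun x y hxy => ?_
  by_contra hne
  have h1 := hΛ x x.2 y y.2 fun h => hne (Subtype.ext h)
  have h2 := Int.abs_sub_lt_one_of_floor_eq_floor hxy
  rw [← sub_div, abs_div, abs_of_pos hδ, div_lt_one hδ] at h2
  linarith

/-- Piece `j` lies in `[j, ∞)` whatever `N j` is, so the union is locally finite. -/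
theorem isClosed_iUnion_affine {N : ℕ → ℝ} (hN : ∀ j, 0 < N j) {L : Set ℝ}
    (hL : L ⊆ Set.Icc 0 1) (hLc : IsClosed L) :
    IsClosed (⋃ j : ℕ, (fun t : ℝ => j + N j * t) '' L) := by
  have hLk : IsCompact L := isCompact_Icc.of_isClosed_subset hLc hL
  refine LocallyFinite.isClosed_iUnion (fun x => ⟨Set.Iio (x + 1), Iio_mem_nhds (lt_add_one x), ?_⟩)
    fun j => (hLk.image (by fun_prop)).isClosed
  obtain ⟨n, hn⟩ := exists_nat_gt (x + 1)
  refine (Set.finite_lt_nat n).subset ?_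
  rintro j ⟨_, ⟨t, ht, rfl⟩, hj⟩
  have h1 := mul_nonneg (hN j).le (hL ht).1
  have h2 : (j : ℝ) + N j * t < x + 1 := hj
  exact_mod_cast (by linarith : (j : ℝ) < n)

theorem exists_scale {G : ℝ → ℂ} (hG : Tendsto G (cocompact ℝ) (𝓝 0)) {ε r : ℝ} (hε : 0 < ε)
    (hr : 0 < r) : ∃ N : ℝ, 0 < N ∧ ∀ y, r ≤ |y| → ‖G (N * y)‖ ≤ ε := by
  have h1 : ∀ᶠ x in cocompact ℝ, ‖G x‖ < ε := by
    simpa using hG.eventually (Metric.ball_mem_nhds 0 hε)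
  rw [← Metric.cobounded_eq_cocompact, ← comap_norm_atTop, eventually_comap] at h1
  obtain ⟨X, hX⟩ := eventually_atTop.1 h1
  have hpos : 0 < max X 1 / r := div_pos (by positivity) hr
  refine ⟨max X 1 / r, hpos, fun y hy => (hX _ ?_ _ rfl).le⟩
  rw [norm_mul, Real.norm_of_nonneg hpos.le, Real.norm_eq_abs, div_mul_eq_mul_div, le_div_iff₀ hr]
  exact mul_le_mul (le_max_left _ _) hy hr.le (by positivity)

end Bernstein

/-! ### The set `S` -/

open Bernstein in
theorem theorem3 :
    ∃ S : Set ℝ, IsClosed S ∧ ¬ Bornology.IsBounded S ∧ MeasureTheory.volume S = 0 ∧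
      ∀ Λ : Set ℝ, Bernstein.UniformlyDiscrete Λ → Bernstein.IsInterpolationSet S Λ := by
  obtain ⟨K, G, hK, hKc, hK0, hG, hG1, hGlim, hGK⟩ := exists_null_spectrum_tendsto_zero
  -- The radii `1 / (j + 1)` tend to zero, so one choice of scales serves every separation `δ`.
  choose N hN hNG using fun j : ℕ => exists_scale hGlim (ε := 1 / 2 / 2 / 2 ^ j)
    (r := 1 / ((j : ℝ) + 1)) (by positivity) Nat.one_div_pos_of_nat
  -- Adding 0 puts every natural number in `S`, which gives unboundedness.
  let L : Set ℝ := insert 0 K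
  have hL : L ⊆ Set.Icc 0 1 := Set.insert_subset (by simp) hK
  have hLc : IsClosed L := isClosed_singleton.union hKc
  have hL0 : volume L = 0 := measure_union_null (measure_singleton 0) hK0
  let S : Set ℝ := ⋃ j : ℕ, (fun t : ℝ => j + N j * t) '' L
  have hS : IsClosed S := isClosed_iUnion_affine hN hL hLc
  refine ⟨S, hS, fun hb => ?_, measure_iUnion_null fun j => ?_, fun Λ hΛ => ?_⟩
  · obtain ⟨C, hC⟩ := hb.exists_norm_le
    obtain ⟨n, hn⟩ := exists_nat_gt C
    have := hC n (Set.mem_iUnion.2 ⟨n, 0, by simp [L], by simp⟩)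
    rw [Real.norm_natCast] at this
    linarith
  · exact addHaar_image_eq_zero_of_differentiableOn_of_addHaar_eq_zero volume (by fun_prop) hL0
  · have := hΛ.countable
    obtain ⟨δ, hδ, hsep⟩ := hΛ
    obtain ⟨e, he⟩ := exists_injective_nat Λ
    -- Skipping the first `n` pieces leaves only radii below `δ / 4`; the injection `e` then gives
    -- each point its own piece and keeps the sum of errors at most 1/2.
    obtain ⟨n, hn⟩ := exists_nat_one_div_lt (show 0 < δ / 4 by positivity)
    let g : ZeroAtInftyContinuousMap ℝ ℂ := ⟨⟨G, hG⟩, hGlim⟩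
    have hGB : ∀ x, ‖G x‖ ≤ ‖g.toBCF‖ := g.toBCF.norm_coe_le_norm
    have hgeom : HasSum (fun j : ℕ => (1 : ℝ) / 2 / 2 / 2 ^ j) (1 / 2) := hasSum_geometric_two' _
    refine isInterpolationSet_of_peaks hS hδ hsep (B := ‖g.toBCF‖)
      (f := fun y x => cexp (I * ((n + e y : ℕ) : ℝ) * ((x - y : ℝ) : ℂ)) *
        G (N (n + e y) * (x - y)))
      (ε := fun y => 1 / 2 / 2 / 2 ^ e y)
      (fun y => by fun_prop) (fun y => ?_) (fun y x => ?_) (fun y => by simp [hG1]) (fun y x hx => ?_)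
      (fun y => by positivity) (hgeom.summable.comp_injective he) ?_
    · exact (hGK.affine ((n + e y : ℕ) : ℝ) y (hN (n + e y))).mono
        ((Set.image_mono (Set.subset_insert 0 K)).trans
          (Set.subset_iUnion (fun j : ℕ => (fun t : ℝ => (j : ℝ) + N j * t) '' L) (n + e y)))
    · rw [norm_mul, norm_cexp_I_mul_mul, one_mul]
      exact hGB _
    · rw [norm_mul, norm_cexp_I_mul_mul, one_mul]
      refine (hNG (n + e y) (x - y) ?_).trans ?_
      · exact (Nat.one_div_le_one_div (Nat.le_add_right n (e y))).trans (hn.le.trans hx)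
      · gcongr
        · norm_num
        · omega
    · refine (hgeom.summable.comp_injective he).tsum_le_tsum_of_inj e he (fun _ _ => by positivity)
        (fun _ => le_rfl) hgeom.summable |>.trans_eq hgeom.tsum_eq
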